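/- Let $0<p\le 1$ and let $A$ be a unital associative complex algebra with a map $\|\cdot\|:A\to[0,\infty)$ such that $\|a\|=0$ only if $a=0$, $\|a+b\|\le\|a\|+\|b\|$, $\|\alpha a\|=|\alpha|^{p}\|a\|$ and $\|ab\|\le\|a\|\,\|b\|$ for all $a,b\in A$, $\alpha\in\mathbb C$ (a complex $p$-normed algebra). Let $*$ be an involution on $A$, that is, $(a^*)^*=a$, $(a+b)^*=a^*+b^*$, $(\alpha a)^*=\bar\alpha a^*$, $(ab)^*=b^*a^*$ (continuity is not assumed). Let $B$ be the completion of $A$ for the metric $\|a-b\|$, with the extended norm and operations, and let $M(B)$ be the set of all nonzero continuous multiplicative linear functionals $f:B\to\mathbb C$ with the topology of pointwise convergence on $B$. Assume that 1. there is a constant $m>0$ with $\|a\|^2\le m\|a^2\|$ for all $a\in A$; 2. for every $h\in A$ with $h^*=h$, the spectrum $\{\lambda\in\mathbb C:\lambda e-h \text{ is not invertible in } B\}$ is contained in $\mathbb R$. Then the involution is continuous on $A$. Moreover $M(B)$ is compact, the involution of $A$ extends to a continuous involution on $B$ (again denoted $*$), and the Gelfand map $G:B\to C(M(B))$, $G(b)(f)=f(b)$,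 is a bijective algebra homomorphism onto the algebra of all continuous complex-valued functions on $M(B)$ with $G(b^*)=\overline{G(b)}$ for all $b\in B$ and $$m^{-2/p}\|b\|^{1/p}\le\|G(b)\|_s\le\|b\|^{1/p}\qquad(b\in B),$$ where $\|\cdot\|_s$ is the supremum norm on $C(M(B))$. -/

import Mathlib

/-- A (unital, associative) complex `p`-normed algebra, `0 < p ≤ 1`.  `NormedRing A` supplies a norm
that is subadditive, separating and submultiplicative, with the metric `‖a - b‖`; nothing is required
of `‖1‖`.  Homogeneity, which `NormedRing` does not mention, is of degree `p`. -/
class PNormedAlgebra (p : outParam ℝ) (A : Type*) [NormedRing A] [Algebra ℂ A] : Prop where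
  p_pos : 0 < p
  p_le_one : p ≤ 1
  norm_smul_eq : ∀ (α : ℂ) (a : A), ‖α • a‖ = ‖α‖ ^ p * ‖a‖

/-- Scalar multiplications of a `p`-normed algebra are uniformly continuous; hence the metric
completion `UniformSpace.Completion A` is a complex algebra. -/
instance PNormedAlgebra.instUniformContinuousConstSMul {p : ℝ} {A : Type*} [NormedRing A]
    [Algebra ℂ A] [PNormedAlgebra p A] : UniformContinuousConstSMul ℂ A where
  uniformContinuous_const_smul α := by
    refine (LipschitzWith.of_dist_le_mul (K := ‖α‖₊ ^ p) fun x y => ?_).uniformContinuous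
    rw [dist_eq_norm, dist_eq_norm, ← smul_sub, PNormedAlgebra.norm_smul_eq (p := p)]
    simp

/-! The square inequality passes to the completion `B` and lets the growth of `‖b ^ n‖` determine
`‖b‖` up to the factor `m` (`norm_le_of_norm_pow_le`). Similar elements have comparable power
growth, so `z ↦ exp (z a) * b * exp (-z a)` is a bounded entire function. A Liouville theorem valid
without local convexity (`coeff_eq_zero_of_bounded`) kills its first coefficient `a b - b a`, and
`B` is commutative.

For commuting elements the optimal growth rate `powNorm` is a genuine algebra norm whose `p`-th
power is equivalent to the given norm. Banach algebra theory then provides characters with `(‖b‖ /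
m) ^ p⁻¹ ≤ ‖f b‖` (`exists_algHom_rpow_norm_le`), so the Gelfand map is bounded below and has closed
range. Real spectra of self-adjoint elements turn `star` into complex conjugation on the image of
`A`, and Stone–Weierstrass gives surjectivity. Conjugation, pulled back along the Gelfand map, is
the involution on `B`. -/

section

/-! ### Growth of powers under the square inequality. -/

open Finset Filter Topology

/-- A geometric sequence that dominates another one up to a linear factor, along the powers of `2`,
has the larger ratio. -/
theorem le_of_pow_two_pow_le {s t C : ℝ} (ht : 0 ≤ t)
    (h : ∀ k : ℕ, s ^ (2 ^ k) ≤ C * ((2 ^ k : ℕ) + 1) * t ^ (2 ^ k)) : s ≤ t := by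
  by_contra! hlt
  rcases ht.eq_or_lt with rfl | ht
  · have := h 0
    simp only [pow_zero, pow_one, mul_zero] at this
    linarith
  have hr : 1 < s / t := (one_lt_div ht).2 hlt
  have hlim : Tendsto (fun n : ℕ => C * ((n : ℝ) ^ 1 / (s / t) ^ n + (n : ℝ) ^ 0 / (s / t) ^ n))
      atTop (𝓝 (C * (0 + 0))) :=
    ((tendsto_pow_const_div_const_pow_of_one_lt 1 hr).add
      (tendsto_pow_const_div_const_pow_of_one_lt 0 hr)).const_mul C
  have hlim2 := hlim.comp (tendsto_pow_atTop_atTop_of_one_lt (one_lt_two (α := ℕ)))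
  simp only [add_zero, mul_zero] at hlim2
  obtain ⟨k, hk⟩ := (hlim2.eventually (gt_mem_nhds one_pos)).exists
  have hpos : 0 < (s / t) ^ (2 ^ k) := by positivity
  have htp : 0 < t ^ (2 ^ k) := by positivity
  have h2 := h k
  have h3 : (s / t) ^ (2 ^ k) ≤ C * ((2 ^ k : ℕ) + 1) := by
    rw [div_pow, div_le_iff₀ htp]; exact h2
  simp only [Function.comp, pow_one, pow_zero] at hk
  rw [← add_div, mul_div_assoc', div_lt_one hpos] at hk
  linarith

section Square

variable {B : Type*} [NormedRing B] {m : ℝ}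

/-- Repeated squaring accumulates the constant `m ^ (2 ^ k - 1)`; the factor `m` on the left avoids
the subtraction. -/
theorem norm_pow_two_pow_le (hm : 0 < m) (hsq : ∀ b : B, ‖b‖ ^ 2 ≤ m * ‖b ^ 2‖) (b : B) (k : ℕ) :
    ‖b‖ ^ (2 ^ k) * m ≤ m ^ (2 ^ k) * ‖b ^ (2 ^ k)‖ := by
  induction k with
  | zero => simp [mul_comm]
  | succ k ih =>
    have h1 := pow_le_pow_left₀ (by positivity) ih 2
    have h2 := hsq (b ^ (2 ^ k))
    rw [← pow_mul, ← pow_succ] at h2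
    have h3 : 0 ≤ (m ^ (2 ^ k)) ^ 2 := by positivity
    have h4 := mul_le_mul_of_nonneg_left h2 h3
    have h5 : m * (‖b‖ ^ 2 ^ (k + 1) * m) ≤ m * (m ^ 2 ^ (k + 1) * ‖b ^ 2 ^ (k + 1)‖) := by
      calc m * (‖b‖ ^ 2 ^ (k + 1) * m) = (‖b‖ ^ 2 ^ k * m) ^ 2 := by rw [pow_succ 2 k, pow_mul]; ring
        _ ≤ _ := h1
        _ = (m ^ 2 ^ k) ^ 2 * ‖b ^ 2 ^ k‖ ^ 2 := by ring
        _ ≤ _ := h4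
        _ = _ := by rw [pow_succ 2 k, pow_mul m]; ring
    exact le_of_mul_le_mul_left h5 hm

/-- Under the square inequality, the growth rate of the powers of `b` controls the norm of `b`. -/
theorem norm_le_of_norm_pow_le (hm : 0 < m) (hsq : ∀ b : B, ‖b‖ ^ 2 ≤ m * ‖b ^ 2‖) {b : B}
    {C t : ℝ} (ht : 0 ≤ t) (h : ∀ n : ℕ, ‖b ^ n‖ ≤ C * (n + 1) * t ^ n) : ‖b‖ ≤ m * t := by
  refine le_of_pow_two_pow_le (C := C / m) (by positivity) fun k => ?_
  have h1 := norm_pow_two_pow_le hm hsq b k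
  have h2 := mul_le_mul_of_nonneg_left (h (2 ^ k)) (by positivity : 0 ≤ m ^ (2 ^ k))
  rw [← mul_le_mul_iff_left₀ hm]
  refine h1.trans (h2.trans_eq ?_)
  rw [mul_pow]; field_simp

/-- Similar elements have comparable norms. -/
theorem norm_conj_le (hm : 0 < m) (hsq : ∀ b : B, ‖b‖ ^ 2 ≤ m * ‖b ^ 2‖) {u v : B} (hvu : v * u = 1)
    (huv : u * v = 1) (b : B) : ‖u * b * v‖ ≤ m * ‖b‖ := by
  -- The summand `‖u * v‖` serves only `n = 0`, where `‖b ^ 0‖ ≤ ‖b‖ ^ 0` may fail because `‖1‖` may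
  -- exceed `1`.
  refine norm_le_of_norm_pow_le hm hsq (C := ‖u * v‖ + ‖u‖ * ‖v‖) (norm_nonneg b) fun n => ?_
  have hpow : (u * b * v) ^ n = u * b ^ n * v := by
    induction n with
    | zero => simp [huv]
    | succ n ih => rw [pow_succ, ih, pow_succ]; simp only [mul_assoc]; rw [← mul_assoc v u, hvu, one_mul]
  rw [hpow]
  have hn : (0 : ℝ) ≤ n := n.cast_nonneg
  rcases n.eq_zero_or_pos with rfl | hn'
  · simp; positivity
  calc ‖u * b ^ n * v‖ ≤ ‖u‖ * ‖b‖ ^ n * ‖v‖ := by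
        refine (norm_mul_le _ _).trans ?_
        gcongr
        refine (norm_mul_le _ _).trans ?_
        gcongr
        exact norm_pow_le' b hn'
    _ ≤ _ := by
      have : 0 ≤ ‖b‖ ^ n := by positivity
      have h2 : 0 ≤ ‖u‖ * ‖v‖ := by positivity
      have h3 : 0 ≤ ‖u * v‖ := norm_nonneg _
      have h4 : ‖u‖ * ‖v‖ ≤ (‖u * v‖ + ‖u‖ * ‖v‖) * (n + 1) := by nlinarith
      nlinarith

end Square

/-! ### Cauchy estimates and Liouville's theorem without local convexity. -/

section Liouville

variable {p : ℝ} {B : Type*} [NormedRing B] [Algebra ℂ B] [PNormedAlgebra p B]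

theorem sum_rootsOfUnity_pow_eq {N : ℕ} (hN : N ≠ 0) {ω : ℂ} (hω : IsPrimitiveRoot ω N) {n j : ℕ}
    (hn : n < N) (hj : j < N) :
    ∑ k ∈ range N, ((ω ^ k)⁻¹) ^ j * (ω ^ k) ^ n = if n = j then (N : ℂ) else 0 := by
  have h0 : ω ≠ 0 := hω.ne_zero hN
  have hterm : ∀ k, ((ω ^ k)⁻¹) ^ j * (ω ^ k) ^ n = ((ω ^ j)⁻¹ * ω ^ n) ^ k := fun k => by
    rw [mul_pow, inv_pow, inv_pow, ← pow_mul, ← pow_mul, ← pow_mul, ← pow_mul, mul_comm k j,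
      mul_comm k n]
  simp_rw [hterm]
  split_ifs with h
  · subst h
    simp [h0]
  · have hne : (ω ^ j)⁻¹ * ω ^ n ≠ 1 := fun h1 => h <| hω.pow_inj hn hj <| by
      rw [inv_mul_eq_one₀ (pow_ne_zero _ h0)] at h1; exact h1.symm
    rw [geom_sum_eq hne, mul_pow, inv_pow, ← pow_mul, ← pow_mul, mul_comm j, mul_comm n, pow_mul,
      pow_mul, hω.pow_eq_one]
    simp

/-- Cauchy's estimate for polynomials with coefficients in a `p`-normed space. -/
theorem norm_coeff_le_of_polynomial_bound {N : ℕ} {c : ℕ → B} {r M : ℝ} (hr : 0 ≤ r)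
    (h : ∀ z : ℂ, ‖z‖ = r → ‖∑ n ∈ range N, z ^ n • c n‖ ≤ M) {j : ℕ} (hj : j < N) :
    (r ^ p) ^ j * ‖c j‖ ≤ N * M := by
  have hp : 0 < p := PNormedAlgebra.p_pos B
  have hN : N ≠ 0 := by omega
  set ω := Complex.exp (2 * Real.pi * Complex.I / N)
  have hω : IsPrimitiveRoot ω N := Complex.isPrimitiveRoot_exp N hN
  have hω1 : ‖ω‖ = 1 := hω.norm'_eq_one hN
  -- Discrete Fourier inversion over the `N`-th roots of unity replaces Cauchy's integral.
  -- Subadditivity then costs a factor `N`, which homogeneity of degree `p` cannot fully recover.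
  have key : ∑ k ∈ range N, ((ω ^ k)⁻¹) ^ j • ∑ n ∈ range N, ((r : ℂ) * ω ^ k) ^ n • c n
      = ((N : ℂ) * (r : ℂ) ^ j) • c j := by
    simp_rw [smul_sum, smul_smul]
    rw [sum_comm]
    simp_rw [← sum_smul]
    have : ∀ n ∈ range N, (∑ k ∈ range N, ((ω ^ k)⁻¹) ^ j * ((r : ℂ) * ω ^ k) ^ n) • c n
        = if n = j then ((N : ℂ) * (r : ℂ) ^ j) • c j else 0 := fun n hn => by
      have h1 : ∑ k ∈ range N, ((ω ^ k)⁻¹) ^ j * ((r : ℂ) * ω ^ k) ^ n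
          = (r : ℂ) ^ n * ∑ k ∈ range N, ((ω ^ k)⁻¹) ^ j * (ω ^ k) ^ n := by
        rw [mul_sum]; exact sum_congr rfl fun k _ => by rw [mul_pow]; ring
      rw [h1, sum_rootsOfUnity_pow_eq hN hω (mem_range.1 hn) hj]
      split_ifs with hnj
      · rw [hnj, mul_comm]
      · simp
    rw [sum_congr rfl this, sum_ite_eq' _ j, if_pos (mem_range.2 hj)]
  have hle : ‖((N : ℂ) * (r : ℂ) ^ j) • c j‖ ≤ N * M := by
    rw [← key]
    refine (norm_sum_le _ _).trans ((sum_le_card_nsmul _ _ M fun k _ => ?_).trans_eq (by simp))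
    rw [PNormedAlgebra.norm_smul_eq (p := p), norm_pow, norm_inv, norm_pow, hω1]
    simp only [one_pow, inv_one, Real.one_rpow, one_mul]
    refine h _ ?_
    rw [norm_mul, norm_pow, hω1, one_pow, mul_one, Complex.norm_real, Real.norm_of_nonneg hr]
  refine le_trans ?_ hle
  rw [PNormedAlgebra.norm_smul_eq (p := p), norm_mul, norm_pow, Complex.norm_real,
    Real.norm_of_nonneg hr, Complex.norm_natCast, Real.mul_rpow (by positivity) (by positivity),
    ← Real.rpow_pow_comm hr]
  gcongr
  refine le_mul_of_one_le_left (by positivity) (Real.one_le_rpow ?_ hp.le)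
  exact_mod_cast Nat.one_le_iff_ne_zero.2 hN

/-- The bound `y ^ n / n! ≤ exp (2 * y) * 2⁻ⁿ` is geometric, and a geometric bound survives `p`-th
powers. -/
theorem summable_pow_div_factorial_rpow (hp : 0 < p) {y : ℝ} (hy : 0 ≤ y) :
    Summable fun n : ℕ => (y ^ n / n.factorial) ^ p := by
  have hq : ((1 / 2 : ℝ) ^ p) < 1 := Real.rpow_lt_one (by norm_num) (by norm_num) hp
  refine Summable.of_nonneg_of_le (fun n => by positivity) (fun n => ?_)
    ((summable_geometric_of_lt_one (by positivity) hq).mul_left (Real.exp (2 * y) ^ p))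
  rw [Real.rpow_pow_comm (by norm_num), ← Real.mul_rpow (by positivity) (by positivity)]
  refine Real.rpow_le_rpow (by positivity) ?_ hp.le
  have := Real.pow_div_factorial_le_exp (2 * y) (by positivity) n
  calc y ^ n / n.factorial = (2 * y) ^ n / n.factorial * (1 / 2) ^ n := by
        rw [mul_pow, one_div, inv_pow]; field_simp
    _ ≤ _ := by gcongr

/-- Liouville's theorem for entire functions of order one with values in a `p`-normed algebra. -/
theorem coeff_eq_zero_of_bounded [CompleteSpace B] {c : ℕ → B} {D Y M : ℝ} (hY : 0 < Y)
    (hc : ∀ n, ‖c n‖ ≤ D * (Y ^ n / n.factorial) ^ p)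
    (hM : ∀ z : ℂ, ‖∑' n, z ^ n • c n‖ ≤ M) {j : ℕ} (hj : j ≠ 0) : c j = 0 := by
  have hp : 0 < p := PNormedAlgebra.p_pos B
  have hD : 0 ≤ D := by simpa using (norm_nonneg _).trans (hc 0)
  have hM0 : 0 ≤ M := (norm_nonneg _).trans (hM 0)
  have hterm : ∀ (z : ℂ) n, ‖z ^ n • c n‖ ≤ D * ((‖z‖ * Y) ^ n / n.factorial) ^ p := fun z n => by
    rw [PNormedAlgebra.norm_smul_eq (p := p), norm_pow]
    calc (‖z‖ ^ n) ^ p * ‖c n‖ ≤ (‖z‖ ^ n) ^ p * (D * (Y ^ n / n.factorial) ^ p) := by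
          gcongr; exact hc n
      _ = D * ((‖z‖ ^ n) ^ p * (Y ^ n / n.factorial) ^ p) := by ring
      _ = _ := by
        rw [← Real.mul_rpow (by positivity) (by positivity), mul_pow, mul_div_assoc]
  have hsum : ∀ z : ℂ, Summable fun n => z ^ n • c n := fun z =>
    Summable.of_norm_bounded
      ((summable_pow_div_factorial_rpow hp (by positivity : 0 ≤ ‖z‖ * Y)).mul_left D) (hterm z)
  set q : ℝ := (1 / 2 : ℝ) ^ p
  have hq0 : 0 ≤ q := by positivity
  have hq : q < 1 := Real.rpow_lt_one (by norm_num) (by norm_num) hp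
  -- With this `θ`, `‖z‖ = N * θ` means `‖z‖ * Y = N / (2 e)`. Since `k ^ k / k! ≤ e ^ k`, each term
  -- beyond the first `N` has its `p`-th root factor at most `2⁻ᵏ`, so the tail is bounded uniformly
  -- in `N`.
  set θ : ℝ := 1 / (2 * Real.exp 1 * Y)
  have hθ : 0 < θ := by positivity
  have hpoly : ∀ (N : ℕ) (z : ℂ), ‖z‖ = N * θ →
      ‖∑ n ∈ range N, z ^ n • c n‖ ≤ M + D * (1 - q)⁻¹ := fun N z hz => by
    have htail : ‖∑' n, z ^ (n + N) • c (n + N)‖ ≤ D * (1 - q)⁻¹ := by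
      refine tsum_of_norm_bounded ((hasSum_geometric_of_lt_one hq0 hq).mul_left D) fun n => ?_
      refine (hterm z (n + N)).trans ?_
      gcongr
      have h1 : (‖z‖ * Y) ^ (n + N) / (n + N).factorial ≤ (1 / 2) ^ (n + N) := by
        have h2 := Real.pow_div_factorial_le_exp ((n + N : ℕ) : ℝ) (by positivity) (n + N)
        have h3 : ‖z‖ * Y ≤ (n + N : ℕ) * (1 / 2 * (Real.exp 1)⁻¹) := by
          rw [hz]
          have : (N : ℝ) * θ * Y = N * (1 / 2 * (Real.exp 1)⁻¹) := by
            simp only [θ]; field_simp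
          rw [this]
          gcongr
          omega
        have h4 : Real.exp ((n + N : ℕ) : ℝ) = Real.exp 1 ^ (n + N) := by
          rw [← Real.exp_nat_mul, mul_one]
        calc (‖z‖ * Y) ^ (n + N) / (n + N).factorial
            ≤ ((n + N : ℕ) * (1 / 2 * (Real.exp 1)⁻¹)) ^ (n + N) / (n + N).factorial := by gcongr
          _ = ((n + N : ℕ) : ℝ) ^ (n + N) / (n + N).factorial
                * ((1 / 2) ^ (n + N) * (Real.exp 1 ^ (n + N))⁻¹) := by
              rw [mul_pow, mul_pow, inv_pow]; ring
          _ ≤ Real.exp 1 ^ (n + N) * ((1 / 2) ^ (n + N) * (Real.exp 1 ^ (n + N))⁻¹) := by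
              rw [← h4]; gcongr
          _ = _ := by field_simp
      calc ((‖z‖ * Y) ^ (n + N) / (n + N).factorial) ^ p ≤ ((1 / 2) ^ (n + N)) ^ p := by gcongr
        _ = q ^ (n + N) := by rw [← Real.rpow_pow_comm (by norm_num)]
        _ ≤ q ^ n := pow_le_pow_of_le_one hq0 hq.le (by omega)
    have heq := (hsum z).sum_add_tsum_nat_add N
    rw [eq_sub_of_add_eq heq]
    exact (norm_sub_le _ _).trans (add_le_add (hM z) htail)
  -- The radius grows linearly with the number `N` of terms: Cauchy's estimate reads `N ^ (p * i) *
  -- const ≤ N * const`, impossible for large `N` when `p * i ≥ 2` and `c i ≠ 0`.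
  have hhigh : ∀ i : ℕ, 2 ≤ p * i → c i = 0 := fun i hi => by
    by_contra hne
    have hpos : 0 < (θ ^ p) ^ i * ‖c i‖ := by positivity
    obtain ⟨N, hN⟩ := exists_nat_gt (max (i : ℝ) ((M + D * (1 - q)⁻¹) / ((θ ^ p) ^ i * ‖c i‖)))
    have hNi : i < N := by exact_mod_cast (le_max_left _ _).trans_lt hN
    have hN1 : (1 : ℝ) ≤ N := by exact_mod_cast (by omega : 1 ≤ N)
    have h2 := (div_lt_iff₀ hpos).1 ((le_max_right _ _).trans_lt hN)
    have h1 := norm_coeff_le_of_polynomial_bound (p := p) (by positivity) (hpoly N) hNi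
    have h3 : (N : ℝ) ^ 2 ≤ ((N : ℝ) ^ p) ^ i := by
      rw [← Real.rpow_natCast ((N : ℝ) ^ p), ← Real.rpow_mul (by positivity), ← Real.rpow_two]
      exact Real.rpow_le_rpow_of_exponent_le hN1 hi
    rw [Real.mul_rpow (by positivity) hθ.le, mul_pow, mul_assoc] at h1
    have h4 := (mul_le_mul_of_nonneg_right h3 hpos.le).trans h1
    rw [pow_two, mul_assoc] at h4
    have h5 := le_of_mul_le_mul_left h4 (by linarith)
    linarith
  -- The series is now a polynomial with at most `d` terms, so the loss in Cauchy's estimate is the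
  -- fixed factor `d` and the radius can tend to infinity.
  obtain ⟨d, hd⟩ := exists_nat_ge (2 / p)
  have hzero : ∀ i, d ≤ i → c i = 0 := fun i hi => hhigh i <| by
    rw [div_le_iff₀ hp] at hd
    have : (d : ℝ) ≤ i := by exact_mod_cast hi
    nlinarith
  by_contra hne
  have hjd : j < d := by
    by_contra! h; exact hne (hzero j h)
  have hfin : ∀ z : ℂ, ‖∑ n ∈ range d, z ^ n • c n‖ ≤ M := fun z => by
    have h : ∑' n, z ^ n • c n = ∑ n ∈ range d, z ^ n • c n := tsum_eq_sum fun n hn => by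
      rw [hzero n (by simpa using hn), smul_zero]
    exact h ▸ hM z
  have hall : ∀ r : ℝ, 0 ≤ r → (r ^ p) ^ j * ‖c j‖ ≤ d * M := fun r hr =>
    norm_coeff_le_of_polynomial_bound (p := p) hr (fun z _ => hfin z) hjd
  have hpos : 0 < ‖c j‖ := norm_pos_iff.2 hne
  have htop : Tendsto (fun r : ℝ => (r ^ p) ^ j * ‖c j‖) atTop atTop :=
    ((tendsto_pow_atTop hj).comp (tendsto_rpow_atTop hp)).atTop_mul_const hpos
  obtain ⟨r, hr, hr0⟩ := ((htop.eventually_gt_atTop (d * M)).and (eventually_ge_atTop 0)).exists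
  exact absurd (hall r hr0) hr.not_ge

end Liouville

/-! ### Exponentials and commutativity. -/

section Commutativity

variable {B : Type*} [NormedRing B] [Algebra ℂ B]

/-- The `n`-th term of the exponential series. -/
noncomputable def expTerm (x : B) (n : ℕ) : B := ((n.factorial : ℂ)⁻¹) • x ^ n

theorem expTerm_smul (z : ℂ) (x : B) (n : ℕ) : expTerm (z • x) n = z ^ n • expTerm x n := by
  rw [expTerm, expTerm, smul_pow, smul_comm]

theorem norm_expTerm_le {p : ℝ} [PNormedAlgebra p B] (x : B) (n : ℕ) :
    ‖expTerm x n‖ ≤ (‖(1 : B)‖ + 1) * ((‖x‖ ^ p⁻¹) ^ n / n.factorial) ^ p := by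
  have hp : 0 < p := PNormedAlgebra.p_pos B
  have hpow : ‖x ^ n‖ ≤ (‖(1 : B)‖ + 1) * ‖x‖ ^ n := by
    rcases n.eq_zero_or_pos with rfl | hn
    · simp
    · exact (norm_pow_le' x hn).trans
        (le_mul_of_one_le_left (by positivity) (by linarith [norm_nonneg (1 : B)]))
  rw [expTerm, PNormedAlgebra.norm_smul_eq (p := p), norm_inv, Complex.norm_natCast, div_eq_inv_mul,
    Real.mul_rpow (by positivity) (by positivity), ← Real.rpow_pow_comm (by positivity),
    Real.rpow_inv_rpow (by positivity) hp.ne', mul_left_comm]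
  gcongr

theorem summable_norm_expTerm (p : ℝ) [PNormedAlgebra p B] (x : B) : Summable fun n => ‖expTerm x n‖ :=
  Summable.of_nonneg_of_le (fun _ => norm_nonneg _) (norm_expTerm_le x)
    ((summable_pow_div_factorial_rpow (PNormedAlgebra.p_pos B) (by positivity)).mul_left _)

variable [CompleteSpace B]

theorem tsum_expTerm_mul_tsum_expTerm_neg (p : ℝ) [PNormedAlgebra p B] (x : B) :
    (∑' n, expTerm x n) * ∑' n, expTerm (-x) n = 1 := by
  rw [tsum_mul_tsum_eq_tsum_sum_antidiagonal_of_summable_norm (summable_norm_expTerm p x)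
    (summable_norm_expTerm p (-x))]
  have h : ∀ n, ∑ kl ∈ antidiagonal n, expTerm x kl.1 * expTerm (-x) kl.2 = expTerm (x + -x) n := by
    intro n
    rw [expTerm, (Commute.refl x).neg_right.add_pow', smul_sum]
    refine sum_congr rfl fun kl hkl => ?_
    rw [expTerm, expTerm, smul_mul_smul_comm, ← Nat.cast_smul_eq_nsmul ℂ, smul_smul]
    congr 1
    rw [← mem_antidiagonal.1 hkl, Nat.cast_add_choose]
    have := Nat.cast_ne_zero (R := ℂ).2 (kl.1 + kl.2).factorial_ne_zero
    field_simp
  simp_rw [h, add_neg_cancel]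
  rw [tsum_eq_single 0 fun n hn => by simp [expTerm, hn]]
  simp [expTerm]

/-- The coefficients of `z ↦ exp (z a) * b * exp (- z a)`. -/
noncomputable def conjCoeff (a b : B) (n : ℕ) : B :=
  ∑ kl ∈ antidiagonal n, expTerm a kl.1 * b * expTerm (-a) kl.2

theorem tsum_pow_smul_conjCoeff (p : ℝ) [PNormedAlgebra p B] (a b : B) (z : ℂ) :
    ∑' n, z ^ n • conjCoeff a b n
      = (∑' n, expTerm (z • a) n) * b * ∑' n, expTerm (-(z • a)) n := by
  have hs := summable_norm_expTerm p (z • a)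
  rw [← hs.of_norm.tsum_mul_right,
    tsum_mul_tsum_eq_tsum_sum_antidiagonal_of_summable_norm _ (summable_norm_expTerm p (-(z • a)))]
  · refine tsum_congr fun n => ?_
    rw [conjCoeff, smul_sum]
    refine sum_congr rfl fun kl hkl => ?_
    rw [← smul_neg, expTerm_smul, expTerm_smul, smul_mul_assoc, smul_mul_smul_comm, ← pow_add,
      mem_antidiagonal.1 hkl]
  · exact Summable.of_nonneg_of_le (fun _ => norm_nonneg _) (fun _ => norm_mul_le _ _)
      (hs.mul_right ‖b‖)

-- In the base of the power, `2` bounds the binomial coefficients by `2 ^ n`, `2 ^ p⁻¹` absorbs the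
-- `n + 1` summands after the `p`-th power, and `+ 1` keeps the base positive, as Liouville's
-- theorem requires.
omit [CompleteSpace B] in
theorem norm_conjCoeff_le {p : ℝ} [PNormedAlgebra p B] (a b : B) (n : ℕ) :
    ‖conjCoeff a b n‖ ≤ (‖(1 : B)‖ + 1) ^ 2 * ‖b‖ *
      ((2 * 2 ^ p⁻¹ * (‖a‖ ^ p⁻¹ + 1)) ^ n / n.factorial) ^ p := by
  have hp : 0 < p := PNormedAlgebra.p_pos B
  set y := ‖a‖ ^ p⁻¹ with hy
  have hy0 : 0 ≤ y := by positivity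
  have hterm : ∀ kl ∈ antidiagonal n, ‖expTerm a kl.1 * b * expTerm (-a) kl.2‖
      ≤ (‖(1 : B)‖ + 1) ^ 2 * ‖b‖ * ((2 * (y + 1)) ^ n / n.factorial) ^ p := fun kl hkl => by
    have h1 := norm_expTerm_le a kl.1
    have h2 := norm_expTerm_le (-a) kl.2
    rw [norm_neg] at h2
    rw [← hy] at h1 h2
    calc _ ≤ ‖expTerm a kl.1‖ * ‖b‖ * ‖expTerm (-a) kl.2‖ := by
          refine (norm_mul_le _ _).trans ?_
          gcongr
          exact norm_mul_le _ _
      _ ≤ ((‖(1 : B)‖ + 1) * (y ^ kl.1 / kl.1.factorial) ^ p) * ‖b‖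
            * ((‖(1 : B)‖ + 1) * (y ^ kl.2 / kl.2.factorial) ^ p) := by gcongr
      _ = (‖(1 : B)‖ + 1) ^ 2 * ‖b‖
            * (y ^ kl.1 / kl.1.factorial * (y ^ kl.2 / kl.2.factorial)) ^ p := by
          rw [Real.mul_rpow (by positivity) (by positivity)]; ring
      _ ≤ _ := by
          have h3 : y ^ kl.1 / kl.1.factorial * (y ^ kl.2 / kl.2.factorial)
              = y ^ n * (n.choose kl.1 : ℝ) / n.factorial := by
            rw [← mem_antidiagonal.1 hkl, Nat.cast_add_choose, pow_add]
            field_simp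
          rw [h3]
          gcongr
          rw [mul_pow, mul_comm]
          gcongr
          · exact_mod_cast n.choose_le_two_pow kl.1
          · linarith
  refine (norm_sum_le _ _).trans ((sum_le_card_nsmul _ _ _ hterm).trans ?_)
  rw [Nat.card_antidiagonal, nsmul_eq_mul]
  have h2 : ((2 * 2 ^ p⁻¹ * (y + 1)) ^ n / n.factorial) ^ p
      = (2 : ℝ) ^ n * ((2 * (y + 1)) ^ n / n.factorial) ^ p := by
    have h3 : (2 : ℝ) ^ n = (((2 : ℝ) ^ p⁻¹) ^ n) ^ p := by
      rw [← Real.rpow_pow_comm (by positivity), Real.rpow_inv_rpow (by positivity) hp.ne']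
    rw [h3, ← Real.mul_rpow (by positivity) (by positivity)]
    congr 1
    rw [mul_right_comm 2, mul_pow, mul_comm, mul_div_assoc]
  rw [h2, mul_left_comm]
  gcongr
  exact_mod_cast n.lt_two_pow_self

/-- A complete `p`-normed algebra with `‖b‖ ^ 2 ≤ m * ‖b ^ 2‖` is commutative. -/
theorem PNormedAlgebra.mul_comm_of_norm_sq_le (p : ℝ) [PNormedAlgebra p B] {m : ℝ} (hm : 0 < m)
    (hsq : ∀ b : B, ‖b‖ ^ 2 ≤ m * ‖b ^ 2‖) (a b : B) : a * b = b * a := by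
  -- The first coefficient is the commutator; the bound `m * ‖b‖` is uniform in `z` because each
  -- value is similar to `b`.
  have h : conjCoeff a b 1 = 0 :=
    coeff_eq_zero_of_bounded (p := p) (by positivity) (norm_conjCoeff_le a b) (M := m * ‖b‖)
      (fun z => by
        rw [tsum_pow_smul_conjCoeff p]
        refine norm_conj_le hm hsq ?_ (tsum_expTerm_mul_tsum_expTerm_neg p _) b
        simpa using tsum_expTerm_mul_tsum_expTerm_neg p (-(z • a))) one_ne_zero
  simp only [conjCoeff, expTerm, Nat.antidiagonal_succ, Nat.antidiagonal_zero] at h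
  simp at h
  rw [← sub_eq_zero, ← h]
  abel

end Commutativity

/-! ### The growth rate as a homogeneous norm. -/

section Renorming

variable {p : ℝ} {B : Type*} [NormedRing B] [Algebra ℂ B] [PNormedAlgebra p B]

/-- `t` bounds the growth of the powers of `b`, on the homogeneous scale. -/
def IsPowBound (p m : ℝ) (b : B) (t : ℝ) : Prop := 0 ≤ t ∧ ∀ n : ℕ, ‖b ^ n‖ ≤ m * (t ^ p) ^ n

/-- The least bound for the growth of the powers of `b`: the `p`-th root of the spectral radius when
the square inequality holds with constant `m`. -/
noncomputable def powNorm (p m : ℝ) (b : B) : ℝ := sInf {t | IsPowBound p m b t}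

variable {m : ℝ}

-- Applying `norm_le_of_norm_pow_le` to every power `b ^ k` improves any constant `C`, even with a
-- linear factor, to the constant `m`. This is what makes growth bounds stable under sums and
-- products.
omit [Algebra ℂ B] [PNormedAlgebra p B] in
theorem isPowBound_of_norm_pow_le (hm : 0 < m) (hsq : ∀ b : B, ‖b‖ ^ 2 ≤ m * ‖b ^ 2‖) {b : B}
    {C t : ℝ} (ht : 0 ≤ t) (hC : 0 ≤ C) (h : ∀ n : ℕ, ‖b ^ n‖ ≤ C * (n + 1) * (t ^ p) ^ n) :
    IsPowBound p m b t := by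
  refine ⟨ht, fun k => norm_le_of_norm_pow_le hm hsq (C := C * (k + 1)) (by positivity) fun n => ?_⟩
  rw [← pow_mul, ← pow_mul]
  refine (h (k * n)).trans ?_
  rw [mul_assoc C (k + 1 : ℝ)]
  refine mul_le_mul_of_nonneg_right (mul_le_mul_of_nonneg_left ?_ hC) (by positivity)
  push_cast
  nlinarith [(Nat.cast_nonneg k : (0 : ℝ) ≤ k), (Nat.cast_nonneg n : (0 : ℝ) ≤ n)]

theorem isPowBound_norm_rpow (hm : 0 < m) (hsq : ∀ b : B, ‖b‖ ^ 2 ≤ m * ‖b ^ 2‖) (b : B) :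
    IsPowBound p m b (‖b‖ ^ p⁻¹) := by
  refine isPowBound_of_norm_pow_le hm hsq (C := ‖(1 : B)‖ + 1) (by positivity) (by positivity)
    fun n => ?_
  rw [Real.rpow_inv_rpow (by positivity) (PNormedAlgebra.p_pos B).ne']
  have h1 : 0 ≤ ‖(1 : B)‖ := norm_nonneg _
  rcases n.eq_zero_or_pos with rfl | hn
  · simp
  · refine (norm_pow_le' b hn).trans (le_mul_of_one_le_left (by positivity) ?_)
    nlinarith [(Nat.cast_nonneg n : (0 : ℝ) ≤ n)]

omit [Algebra ℂ B] [PNormedAlgebra p B] in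
theorem powNorm_le {b : B} {t : ℝ} (h : IsPowBound p m b t) : powNorm p m b ≤ t :=
  csInf_le ⟨0, fun _ h => h.1⟩ h

theorem isPowBound_powNorm (hm : 0 < m) (hsq : ∀ b : B, ‖b‖ ^ 2 ≤ m * ‖b ^ 2‖) (b : B) :
    IsPowBound p m b (powNorm p m b) := by
  have hp : 0 < p := PNormedAlgebra.p_pos B
  refine IsClosed.csInf_mem (s := {t | IsPowBound p m b t}) ?_ ⟨_, isPowBound_norm_rpow hm hsq b⟩
    ⟨0, fun _ h => h.1⟩
  simp only [IsPowBound, Set.ofPred_and, Set.ofPred_forall]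
  refine (isClosed_le continuous_const continuous_id).inter (isClosed_iInter fun n => ?_)
  exact isClosed_le continuous_const
    (continuous_const.mul ((Real.continuous_rpow_const hp.le).pow n))

theorem IsPowBound.smul {b : B} {t : ℝ} (h : IsPowBound p m b t) (z : ℂ) :
    IsPowBound p m (z • b) (‖z‖ * t) := by
  have ht := h.1
  refine ⟨by positivity, fun n => ?_⟩
  rw [smul_pow, PNormedAlgebra.norm_smul_eq (p := p), Real.mul_rpow (by positivity) h.1, mul_pow,
    norm_pow, ← Real.rpow_pow_comm (by positivity), mul_left_comm]
  gcongr
  exact h.2 n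

omit [Algebra ℂ B] [PNormedAlgebra p B] in
theorem IsPowBound.mul (hm : 0 < m) (hsq : ∀ b : B, ‖b‖ ^ 2 ≤ m * ‖b ^ 2‖) {a b : B} {s t : ℝ}
    (hab : Commute a b) (ha : IsPowBound p m a s) (hb : IsPowBound p m b t) :
    IsPowBound p m (a * b) (s * t) := by
  have hs := ha.1
  have ht := hb.1
  refine isPowBound_of_norm_pow_le hm hsq (C := m ^ 2) (by positivity) (by positivity) fun n => ?_
  rw [hab.mul_pow, Real.mul_rpow hs ht, mul_pow]
  calc ‖a ^ n * b ^ n‖ ≤ (m * (s ^ p) ^ n) * (m * (t ^ p) ^ n) :=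
        (norm_mul_le _ _).trans (mul_le_mul (ha.2 n) (hb.2 n) (norm_nonneg _) (by positivity))
    _ = m ^ 2 * 1 * ((s ^ p) ^ n * (t ^ p) ^ n) := by ring
    _ ≤ _ := by
      gcongr
      linarith [(Nat.cast_nonneg n : (0 : ℝ) ≤ n)]

/-- In the binomial expansion each of the `n + 1` terms is at most `m ^ 2 * ((s + t) ^ p) ^ n`,
since one term of `(s + t) ^ n` is at most the whole. The count `n + 1` is the linear factor that
gets absorbed, leaving true subadditivity. -/
theorem IsPowBound.add (hm : 0 < m) (hsq : ∀ b : B, ‖b‖ ^ 2 ≤ m * ‖b ^ 2‖) {a b : B} {s t : ℝ}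
    (hab : Commute a b) (ha : IsPowBound p m a s) (hb : IsPowBound p m b t) :
    IsPowBound p m (a + b) (s + t) := by
  have hp : 0 < p := PNormedAlgebra.p_pos B
  have hs := ha.1
  have ht := hb.1
  refine isPowBound_of_norm_pow_le hm hsq (C := m ^ 2) (by positivity) (by positivity) fun n => ?_
  rw [hab.add_pow']
  have hterm : ∀ kl ∈ antidiagonal n, ‖n.choose kl.1 • (a ^ kl.1 * b ^ kl.2)‖
      ≤ m ^ 2 * ((s + t) ^ p) ^ n := fun kl hkl => by
    rw [← Nat.cast_smul_eq_nsmul ℂ, PNormedAlgebra.norm_smul_eq (p := p), Complex.norm_natCast]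
    calc (n.choose kl.1 : ℝ) ^ p * ‖a ^ kl.1 * b ^ kl.2‖
        ≤ (n.choose kl.1 : ℝ) ^ p * ((m * (s ^ p) ^ kl.1) * (m * (t ^ p) ^ kl.2)) := by
          gcongr
          exact (norm_mul_le _ _).trans
            (mul_le_mul (ha.2 _) (hb.2 _) (norm_nonneg _) (by positivity))
      _ = m ^ 2 * (n.choose kl.1 * (s ^ kl.1 * t ^ kl.2)) ^ p := by
          rw [Real.mul_rpow (by positivity) (by positivity),
            Real.mul_rpow (by positivity) (by positivity), Real.rpow_pow_comm hs,
            Real.rpow_pow_comm ht]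
          ring
      _ ≤ m ^ 2 * ((s + t) ^ n) ^ p := by
          gcongr
          rw [(Commute.all s t).add_pow']
          refine le_trans (by rw [nsmul_eq_mul]) (single_le_sum
            (f := fun kl : ℕ × ℕ => n.choose kl.1 • (s ^ kl.1 * t ^ kl.2))
            (fun i _ => by positivity) hkl)
      _ = _ := by rw [Real.rpow_pow_comm (by positivity)]
  refine (norm_sum_le _ _).trans ((sum_le_card_nsmul _ _ _ hterm).trans_eq ?_)
  rw [Nat.card_antidiagonal, nsmul_eq_mul]
  push_cast
  ring

end Renorming

/-! ### Characters from Banach algebra theory; Hölder continuity. -/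

/-- In a commutative algebra that is complete for some algebra norm, a lower bound for the spectral
radius is a lower bound for the modulus of some character. -/
theorem exists_algHom_of_pow_le {B : Type*} [Ring B] [Algebra ℂ B] [Nontrivial B]
    (hcomm : ∀ a b : B, a * b = b * a) (N : RingNorm B) (hN : ∀ (z : ℂ) (b : B), N (z • b) ≤ ‖z‖ * N b)
    (hcomplete : ∀ u : ℕ → B, (∀ ε > 0, ∃ K, ∀ i ≥ K, ∀ j ≥ K, N (u i - u j) < ε) →
      ∃ x, ∀ ε > 0, ∃ K, ∀ i ≥ K, N (u i - x) < ε)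
    {b : B} {s : ℝ} (hs0 : 0 ≤ s) (hs : ∀ k : ℕ, s ^ (2 ^ k) ≤ N (b ^ (2 ^ k))) :
    ∃ f : B →ₐ[ℂ] ℂ, s ≤ ‖f b‖ := by
  let nr : NormedRing B := N.toNormedRing
  let : NormedCommRing B := { nr with mul_comm := hcomm }
  let : NormedAlgebra ℂ B := { ‹Algebra ℂ B› with norm_smul_le := hN }
  have hdist : ∀ x y : B, dist x y = N (x - y) := fun x y => dist_eq_norm x y
  have : CompleteSpace B := Metric.complete_of_cauchySeq_tendsto fun u hu => by
    obtain ⟨x, hx⟩ := hcomplete u fun ε hε => by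
      simpa only [hdist] using Metric.cauchySeq_iff.1 hu ε hε
    exact ⟨x, Metric.tendsto_atTop.2 fun ε hε => by simpa only [hdist] using hx ε hε⟩
  -- A spectral value of maximal modulus is attained by a character; Gelfand's formula along the
  -- exponents `2 ^ k` bounds that modulus below by `s`.
  obtain ⟨z, hz, hzr⟩ := spectrum.exists_nnnorm_eq_spectralRadius b
  obtain ⟨f, hf⟩ := WeakDual.CharacterSpace.mem_spectrum_iff_exists.1 hz
  refine ⟨WeakDual.CharacterSpace.toAlgHom f, ?_⟩
  have hlim := spectrum.pow_norm_pow_one_div_tendsto_nhds_spectralRadius b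
  rw [← hzr] at hlim
  have hlim2 := ((ENNReal.tendsto_toReal ENNReal.coe_ne_top).comp hlim).comp
    (tendsto_pow_atTop_atTop_of_one_lt (one_lt_two (α := ℕ)))
  have hfz : ‖WeakDual.CharacterSpace.toAlgHom f b‖ = ((‖z‖₊ : ENNReal)).toReal := by
    rw [← hf]; rfl
  rw [hfz]
  refine ge_of_tendsto' hlim2 fun k => ?_
  simp only [Function.comp]
  rw [ENNReal.toReal_ofReal (by positivity), one_div,
    Real.le_rpow_inv_iff_of_pos hs0 (norm_nonneg _) (by positivity), Real.rpow_natCast]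
  exact hs k

/-- An additive map with a Hölder bound at zero is continuous. -/
theorem continuous_of_norm_map_le_rpow {B E F : Type*} [NormedAddCommGroup B] [NormedAddCommGroup E]
    [FunLike F B E] [AddMonoidHomClass F B E] (f : F) {r : ℝ} (hr : 0 < r)
    (h : ∀ b, ‖f b‖ ≤ ‖b‖ ^ r) : Continuous f := by
  refine continuous_of_continuousAt_zero f ?_
  rw [ContinuousAt, map_zero]
  refine squeeze_zero_norm h ?_
  have : ContinuousAt (fun b : B => ‖b‖ ^ r) 0 :=
    continuous_norm.continuousAt.rpow_const (.inr hr.le)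
  simpa [ContinuousAt, Real.zero_rpow hr.ne'] using this

/-! ### Characters of complete `p`-normed algebras. -/

section Characters

variable {p : ℝ} {B : Type*} [NormedRing B] [Algebra ℂ B] [PNormedAlgebra p B] [CompleteSpace B]

/-- Characters of a complete `p`-normed algebra are automatically bounded. -/
theorem AlgHom.norm_apply_le_rpow_norm (f : B →ₐ[ℂ] ℂ) (b : B) : ‖f b‖ ≤ ‖b‖ ^ p⁻¹ := by
  have hp : 0 < p := PNormedAlgebra.p_pos B
  by_contra! hlt
  have hpos : 0 < ‖f b‖ := (Real.rpow_nonneg (norm_nonneg b) _).trans_lt hlt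
  have hne : f b ≠ 0 := norm_pos_iff.1 hpos
  -- By the Neumann series `1 - (f b)⁻¹ • b` is invertible, yet `f` sends it to `0`.
  have h1 : ‖(f b)⁻¹ • b‖ < 1 := by
    rw [PNormedAlgebra.norm_smul_eq (p := p), norm_inv, Real.inv_rpow hpos.le,
      inv_mul_lt_one₀ (Real.rpow_pos_of_pos hpos _)]
    rwa [← Real.rpow_inv_lt_iff_of_pos (norm_nonneg _) hpos.le hp]
  have h2 := (isUnit_one_sub_of_norm_lt_one h1).map f
  rw [map_sub, map_one, map_smul, smul_eq_mul, inv_mul_cancel₀ hne, sub_self] at h2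
  exact not_isUnit_zero h2

theorem AlgHom.continuous_of_pNormedAlgebra (p : ℝ) [PNormedAlgebra p B] (f : B →ₐ[ℂ] ℂ) :
    Continuous f :=
  continuous_of_norm_map_le_rpow f (inv_pos.2 (PNormedAlgebra.p_pos B)) f.norm_apply_le_rpow_norm

/-- The norm of a commutative `p`-normed algebra with the square inequality is equivalent to the
`p`-th power of an algebra norm. -/
noncomputable def powRingNorm {m : ℝ} (hm : 0 < m) (hsq : ∀ b : B, ‖b‖ ^ 2 ≤ m * ‖b ^ 2‖)
    (hcomm : ∀ a b : B, a * b = b * a) : RingNorm B where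
  toFun := powNorm p m
  map_zero' := by
    have hp : 0 < p := PNormedAlgebra.p_pos B
    refine le_antisymm ?_ (isPowBound_powNorm hm hsq 0).1
    refine (powNorm_le (isPowBound_norm_rpow hm hsq 0)).trans_eq ?_
    rw [norm_zero, Real.zero_rpow (inv_ne_zero hp.ne')]
  add_le' a b := powNorm_le
    (IsPowBound.add hm hsq (hcomm a b) (isPowBound_powNorm hm hsq a) (isPowBound_powNorm hm hsq b))
  neg' b := by
    have h : ∀ x : B, powNorm p m (-x) ≤ powNorm p m x := fun x => by
      simpa using powNorm_le ((isPowBound_powNorm hm hsq x).smul (-1 : ℂ))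
    exact le_antisymm (h b) (by simpa using h (-b))
  mul_le' a b := powNorm_le
    (IsPowBound.mul hm hsq (hcomm a b) (isPowBound_powNorm hm hsq a) (isPowBound_powNorm hm hsq b))
  eq_zero_of_map_eq_zero' b hb := by
    have hp : 0 < p := PNormedAlgebra.p_pos B
    have h := (isPowBound_powNorm (p := p) hm hsq b).2 1
    rw [show powNorm p m b = 0 from hb, Real.zero_rpow hp.ne', pow_one, pow_one, mul_zero] at h
    exact norm_le_zero_iff.1 h

/-- The comparison `‖x‖ ≤ m * powNorm p m x ^ p` and `powNorm p m x ≤ ‖x‖ ^ p⁻¹` transfers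
completeness to `powNorm`, and iterated squaring supplies the lower bound on the powers of `b`. -/
theorem exists_algHom_rpow_norm_le {m : ℝ} (hm : 0 < m) (hsq : ∀ b : B, ‖b‖ ^ 2 ≤ m * ‖b ^ 2‖)
    {b : B} (hb : b ≠ 0) : ∃ f : B →ₐ[ℂ] ℂ, (‖b‖ / m) ^ p⁻¹ ≤ ‖f b‖ := by
  have hp : 0 < p := PNormedAlgebra.p_pos B
  have hcomm := PNormedAlgebra.mul_comm_of_norm_sq_le p hm hsq
  have : Nontrivial B := ⟨b, 0, hb⟩
  have hlow : ∀ x : B, ‖x‖ ≤ m * powNorm p m x ^ p := fun x => by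
    simpa using (isPowBound_powNorm (p := p) hm hsq x).2 1
  have hup : ∀ x : B, powNorm p m x ≤ ‖x‖ ^ p⁻¹ := fun x =>
    powNorm_le (isPowBound_norm_rpow hm hsq x)
  have h0 : ∀ x : B, 0 ≤ powNorm p m x := fun x => (isPowBound_powNorm hm hsq x).1
  refine exists_algHom_of_pow_le hcomm (powRingNorm hm hsq hcomm)
    (fun z x => powNorm_le ((isPowBound_powNorm hm hsq x).smul z)) (fun u hu => ?_)
    (by positivity) fun k => ?_
  · have hcau : CauchySeq u := Metric.cauchySeq_iff.2 fun ε hε => by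
      obtain ⟨K, hK⟩ := hu ((ε / m) ^ p⁻¹) (by positivity)
      refine ⟨K, fun i hi j hj => ?_⟩
      rw [dist_eq_norm]
      refine (hlow _).trans_lt ?_
      rw [← lt_div_iff₀' hm]
      exact (Real.lt_rpow_inv_iff_of_pos (h0 _) (by positivity) hp).1 (hK i hi j hj)
    obtain ⟨x, hx⟩ := cauchySeq_tendsto_of_complete hcau
    refine ⟨x, fun ε hε => ?_⟩
    obtain ⟨K, hK⟩ := Metric.tendsto_atTop.1 hx (ε ^ p) (by positivity)
    refine ⟨K, fun i hi => (hup _).trans_lt ?_⟩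
    rw [Real.rpow_inv_lt_iff_of_pos (norm_nonneg _) hε.le hp, ← dist_eq_norm]
    exact hK i hi
  · change _ ≤ powNorm p m (b ^ 2 ^ k)
    rw [Real.rpow_pow_comm (by positivity),
      Real.rpow_inv_le_iff_of_pos (by positivity) (h0 _) hp, div_pow, div_le_iff₀ (by positivity)]
    have h1 := norm_pow_two_pow_le hm hsq b k
    have h2 := mul_le_mul_of_nonneg_left (hlow (b ^ 2 ^ k)) (by positivity : 0 ≤ m ^ 2 ^ k)
    refine le_of_mul_le_mul_right ((h1.trans h2).trans_eq ?_) hm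
    ring

/-- Tychonoff: since characters are automatically bounded by `‖b‖ ^ p⁻¹`, the algebraic identities
alone, all closed conditions, cut the character space out of a product of discs. The condition `φ 1
= 1` excludes the zero functional. -/
theorem PNormedAlgebra.compactSpace_characterSpace (p : ℝ) [PNormedAlgebra p B] :
    CompactSpace (WeakDual.characterSpace ℂ B) := by
  have hind : IsInducing fun (f : WeakDual.characterSpace ℂ B) (b : B) => f b :=
    (IsInducing.mk rfl : IsInducing fun (f : WeakDual ℂ B) (b : B) => f b).comp .subtypeVal
  set S : Set (B → ℂ) := {φ | φ 1 = 1 ∧ (∀ a b, φ (a + b) = φ a + φ b) ∧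
    (∀ a b, φ (a * b) = φ a * φ b) ∧ (∀ (z : ℂ) b, φ (z • b) = z * φ b)} with hS
  have hSc : IsClosed S := by
    simp only [hS, Set.ofPred_and, Set.ofPred_forall]
    refine (isClosed_eq (by fun_prop) (by fun_prop)).inter (.inter ?_ (.inter ?_ ?_)) <;>
      exact isClosed_iInter fun _ => isClosed_iInter fun _ => isClosed_eq (by fun_prop) (by fun_prop)
  have hbound : ∀ φ ∈ S, ∃ f : B →ₐ[ℂ] ℂ, ∀ b, f b = φ b := fun φ ⟨h1, ha, hm, hs⟩ =>
    ⟨AlgHom.ofLinearMap ⟨⟨φ, ha⟩, hs⟩ h1 hm, fun _ => rfl⟩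
  have hcpt : IsCompact S := by
    refine (isCompact_univ_pi fun b : B => isCompact_closedBall (0 : ℂ) (‖b‖ ^ p⁻¹)).of_isClosed_subset
      hSc fun φ hφ b _ => ?_
    obtain ⟨f, hf⟩ := hbound φ hφ
    rw [mem_closedBall_zero_iff, ← hf]
    exact f.norm_apply_le_rpow_norm b
  refine ⟨hind.isCompact_iff.2 ?_⟩
  convert hcpt
  ext φ
  constructor
  · rintro ⟨f, -, rfl⟩
    exact ⟨map_one f, map_add f, map_mul f, fun z b => by simp⟩
  · intro hφ
    obtain ⟨f, hf⟩ := hbound φ hφ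
    refine ⟨⟨(⟨f.toLinearMap, f.continuous_of_pNormedAlgebra p⟩ : B →L[ℂ] ℂ), ?_⟩, trivial, funext hf⟩
    rw [WeakDual.CharacterSpace.eq_set_map_one_map_mul]
    exact ⟨map_one f, map_mul f⟩

end Characters

/-! ### Two-sided estimates for the Gelfand transform. -/

section Gelfand

open WeakDual

variable {p m : ℝ} {B : Type*} [NormedRing B] [Algebra ℂ B] [PNormedAlgebra p B] [CompleteSpace B]
  [CompactSpace (characterSpace ℂ B)]

theorem norm_gelfandTransform_le (b : B) : ‖gelfandTransform ℂ B b‖ ≤ ‖b‖ ^ p⁻¹ :=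
  (ContinuousMap.norm_le _ (by positivity)).2 fun f =>
    (CharacterSpace.toAlgHom f).norm_apply_le_rpow_norm b

theorem norm_le_norm_gelfandTransform (hm : 0 < m) (hsq : ∀ b : B, ‖b‖ ^ 2 ≤ m * ‖b ^ 2‖) (b : B) :
    ‖b‖ ≤ m * ‖gelfandTransform ℂ B b‖ ^ p := by
  have hp : 0 < p := PNormedAlgebra.p_pos B
  rcases eq_or_ne b 0 with rfl | hb
  · simp [Real.zero_rpow hp.ne']
  obtain ⟨f, hf⟩ := exists_algHom_rpow_norm_le hm hsq hb
  have hmem : StrongDual.toWeakDual (⟨f.toLinearMap, f.continuous_of_pNormedAlgebra p⟩ : B →L[ℂ] ℂ) ∈ characterSpace ℂ B := by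
    rw [CharacterSpace.eq_set_map_one_map_mul]
    exact ⟨map_one f, map_mul f⟩
  have h : ‖f b‖ ≤ ‖gelfandTransform ℂ B b‖ :=
    (gelfandTransform ℂ B b).norm_coe_le_norm ⟨_, hmem⟩
  rw [← div_le_iff₀' hm]
  exact (Real.rpow_inv_le_iff_of_pos (by positivity) (norm_nonneg _) hp).1 (hf.trans h)

theorem continuous_gelfandTransform (p : ℝ) [PNormedAlgebra p B] :
    Continuous (gelfandTransform ℂ B) :=
  continuous_of_norm_map_le_rpow _ (inv_pos.2 (PNormedAlgebra.p_pos B)) norm_gelfandTransform_le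

theorem isClosed_range_gelfandTransform (p : ℝ) [PNormedAlgebra p B] (hm : 0 < m)
    (hsq : ∀ b : B, ‖b‖ ^ 2 ≤ m * ‖b ^ 2‖) : IsClosed (Set.range (gelfandTransform ℂ B)) := by
  have hp : 0 < p := PNormedAlgebra.p_pos B
  refine isClosed_of_closure_subset fun y hy => ?_
  obtain ⟨x, hx, hlim⟩ := mem_closure_iff_seq_limit.1 hy
  choose u hu using hx
  have hcau : CauchySeq u := Metric.cauchySeq_iff.2 fun ε hε => by
    obtain ⟨K, hK⟩ := Metric.cauchySeq_iff.1 hlim.cauchySeq ((ε / m) ^ p⁻¹) (by positivity)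
    refine ⟨K, fun i hi j hj => ?_⟩
    have h := hK i hi j hj
    rw [dist_eq_norm, ← hu, ← hu, ← map_sub] at h
    rw [dist_eq_norm]
    refine (norm_le_norm_gelfandTransform (p := p) hm hsq _).trans_lt ?_
    rw [← lt_div_iff₀' hm]
    exact (Real.lt_rpow_inv_iff_of_pos (norm_nonneg _) (by positivity) hp).1 h
  obtain ⟨b, hb⟩ := cauchySeq_tendsto_of_complete hcau
  refine ⟨b, tendsto_nhds_unique (((continuous_gelfandTransform p).tendsto b).comp hb) ?_⟩
  simpa only [Function.comp_def, hu] using hlim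

theorem gelfandTransform_injective_of_norm_sq_le (p : ℝ) [PNormedAlgebra p B] (hm : 0 < m)
    (hsq : ∀ b : B, ‖b‖ ^ 2 ≤ m * ‖b ^ 2‖) : Function.Injective (gelfandTransform ℂ B) := by
  have hp : 0 < p := PNormedAlgebra.p_pos B
  refine (injective_iff_map_eq_zero _).2 fun b hb => ?_
  have h := norm_le_norm_gelfandTransform (p := p) hm hsq b
  rw [hb, norm_zero, Real.zero_rpow hp.ne', mul_zero] at h
  exact norm_le_zero_iff.1 h

end Gelfand

/-! ### Passage to the completion and Stone–Weierstrass. -/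

section Completion

open UniformSpace WeakDual

variable {p m : ℝ} {A : Type*} [NormedRing A] [Algebra ℂ A] [PNormedAlgebra p A]

instance PNormedAlgebra.instCompletion : PNormedAlgebra p (Completion A) where
  p_pos := PNormedAlgebra.p_pos A
  p_le_one := PNormedAlgebra.p_le_one A
  norm_smul_eq α b := by
    induction b using Completion.induction_on with
    | hp =>
      exact isClosed_eq (continuous_norm.comp (continuous_const_smul α))
        (continuous_const.mul continuous_norm)
    | ih a => rw [← Completion.coe_smul, Completion.norm_coe, Completion.norm_coe, norm_smul_eq]

omit [Algebra ℂ A] [PNormedAlgebra p A] in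
theorem UniformSpace.Completion.norm_sq_le (hsq : ∀ a : A, ‖a‖ ^ 2 ≤ m * ‖a ^ 2‖)
    (b : Completion A) : ‖b‖ ^ 2 ≤ m * ‖b ^ 2‖ := by
  induction b using Completion.induction_on with
  | hp => exact isClosed_le (by fun_prop) (by fun_prop)
  | ih a =>
    rw [pow_two (a : Completion A), ← Completion.coe_mul, Completion.norm_coe, Completion.norm_coe,
      ← pow_two]
    exact hsq a

/-- If self-adjoint elements have real spectrum, the Gelfand transform intertwines the involution
with complex conjugation. -/
theorem gelfandTransform_coe_star (p : ℝ) [PNormedAlgebra p A] [StarRing A] [StarModule ℂ A]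
    (hspec : ∀ h : A, IsSelfAdjoint h → ∀ z ∈ spectrum ℂ (h : Completion A), z.im = 0) (a : A) :
    gelfandTransform ℂ (Completion A) ((star a : A) : Completion A)
      = star (gelfandTransform ℂ (Completion A) (a : Completion A)) := by
  ext f
  have hreal : ∀ h : A, IsSelfAdjoint h → (f (h : Completion A)).im = 0 := fun h hh =>
    hspec h hh _ (AlgHom.apply_mem_spectrum f (h : Completion A))
  have h1 := hreal (a + star a) (IsSelfAdjoint.add_star_self a)
  have h2 := hreal (Complex.I • (a - star a)) (by
    rw [IsSelfAdjoint, star_smul, star_sub, star_star, Complex.star_def, Complex.conj_I, neg_smul,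
      ← smul_neg, neg_sub])
  rw [Completion.coe_add, map_add, Complex.add_im] at h1
  rw [Completion.coe_smul, Completion.coe_sub, map_smul, map_sub, smul_eq_mul, Complex.I_mul_im,
    Complex.sub_re] at h2
  change f ((star a : A) : Completion A) = star (f (a : Completion A))
  apply Complex.ext
  · simp only [Complex.star_def, Complex.conj_re]; linarith
  · simp only [Complex.star_def, Complex.conj_im]; linarith

/-- Stone–Weierstrass is applied to the image of `A`, as `B` carries no involution yet. Points are
separated because continuous characters agreeing on the dense `A` coincide; density of the image and
closedness of the range finish. -/
theorem gelfandTransform_completion_surjective (p : ℝ) [PNormedAlgebra p A] [StarRing A]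
    [StarModule ℂ A] [CompactSpace (characterSpace ℂ (Completion A))] (hm : 0 < m)
    (hsq : ∀ a : A, ‖a‖ ^ 2 ≤ m * ‖a ^ 2‖)
    (hstar : ∀ a : A, gelfandTransform ℂ (Completion A) ((star a : A) : Completion A)
      = star (gelfandTransform ℂ (Completion A) (a : Completion A))) :
    Function.Surjective (gelfandTransform ℂ (Completion A)) := by
  let S : StarSubalgebra ℂ C(characterSpace ℂ (Completion A), ℂ) :=
    { carrier := Set.range fun a : A => gelfandTransform ℂ (Completion A) a
      mul_mem' := by
        rintro _ _ ⟨a, rfl⟩ ⟨b, rfl⟩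
        exact ⟨a * b, by simp only [Completion.coe_mul, map_mul]⟩
      add_mem' := by
        rintro _ _ ⟨a, rfl⟩ ⟨b, rfl⟩
        exact ⟨a + b, by simp only [Completion.coe_add, map_add]⟩
      algebraMap_mem' := fun z => ⟨z • 1, by
        simp only [Completion.coe_smul, Completion.coe_one, map_smul, map_one,
          Algebra.algebraMap_eq_smul_one]⟩
      star_mem' := by
        rintro _ ⟨a, rfl⟩
        exact ⟨star a, hstar a⟩ }
  have hsep : S.SeparatesPoints := fun f g hfg => by
    by_contra! h
    refine hfg (Subtype.ext (DFunLike.ext _ _ fun b => ?_))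
    refine congrFun (Completion.ext (map_continuous f) (map_continuous g) fun a => ?_) b
    exact h _ ⟨_, ⟨a, rfl⟩, rfl⟩
  have htop := ContinuousMap.starSubalgebra_topologicalClosure_eq_top_of_separatesPoints S hsep
  intro y
  have hy : y ∈ S.topologicalClosure := htop ▸ trivial
  have hle : (S : Set C(characterSpace ℂ (Completion A), ℂ))
      ⊆ Set.range (gelfandTransform ℂ (Completion A)) := by
    rintro _ ⟨a, rfl⟩; exact ⟨_, rfl⟩
  exact closure_minimal hle
    (isClosed_range_gelfandTransform p hm (Completion.norm_sq_le hsq)) hy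

end Completion

end

/-! ### The involution on the completion and the final estimates. -/

theorem theorem4p5 {A : Type*} [NormedRing A] [Algebra ℂ A] [StarRing A] [StarModule ℂ A]
    (p : ℝ) [PNormedAlgebra p A] (m : ℝ) (hm : 0 < m)
    (hsq : ∀ a : A, ‖a‖ ^ 2 ≤ m * ‖a ^ 2‖)
    (hspec : ∀ h : A, IsSelfAdjoint h →
      ∀ z ∈ spectrum ℂ (h : UniformSpace.Completion A), z.im = 0) :
    Continuous (star : A → A) ∧
    ∃ (_ : CompactSpace (WeakDual.characterSpace ℂ (UniformSpace.Completion A)))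
      (_ : StarRing (UniformSpace.Completion A))
      (_ : StarModule ℂ (UniformSpace.Completion A)),
      Continuous (star : UniformSpace.Completion A → UniformSpace.Completion A) ∧
      (∀ a : A, star (a : UniformSpace.Completion A) = ((star a : A) : UniformSpace.Completion A)) ∧
      Function.Bijective (WeakDual.gelfandTransform ℂ (UniformSpace.Completion A)) ∧
      (∀ b : UniformSpace.Completion A,
        WeakDual.gelfandTransform ℂ (UniformSpace.Completion A) (star b) =
          star (WeakDual.gelfandTransform ℂ (UniformSpace.Completion A) b)) ∧
      ∀ b : UniformSpace.Completion A,
        m ^ (-2 / p) * ‖b‖ ^ (1 / p) ≤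
            ‖WeakDual.gelfandTransform ℂ (UniformSpace.Completion A) b‖ ∧
          ‖WeakDual.gelfandTransform ℂ (UniformSpace.Completion A) b‖ ≤ ‖b‖ ^ (1 / p) := by
  have hp : 0 < p := PNormedAlgebra.p_pos A
  set B := UniformSpace.Completion A
  have hcpt : CompactSpace (WeakDual.characterSpace ℂ B) :=
    PNormedAlgebra.compactSpace_characterSpace p
  have hsqB : ∀ b : B, ‖b‖ ^ 2 ≤ m * ‖b ^ 2‖ := UniformSpace.Completion.norm_sq_le hsq
  have hlow : ∀ b : B, ‖b‖ ≤ m * ‖WeakDual.gelfandTransform ℂ B b‖ ^ p :=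
    norm_le_norm_gelfandTransform hm hsqB
  have hup : ∀ b : B, ‖WeakDual.gelfandTransform ℂ B b‖ ≤ ‖b‖ ^ p⁻¹ := norm_gelfandTransform_le
  have hstar := gelfandTransform_coe_star p hspec
  have hinj := gelfandTransform_injective_of_norm_sq_le p hm hsqB
  have hsurj := gelfandTransform_completion_surjective p hm hsq hstar
  -- Conjugation preserves the supremum norm, so going through the Gelfand map and back costs only
  -- `m`; this bounds the involution on both `A` and `B`.
  have hle : ∀ b c : B, WeakDual.gelfandTransform ℂ B c = star (WeakDual.gelfandTransform ℂ B b) →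
      ‖c‖ ≤ m * ‖b‖ := fun b c hbc => by
    refine (hlow c).trans ?_
    rw [hbc, norm_star]
    gcongr
    exact (Real.le_rpow_inv_iff_of_pos (norm_nonneg _) (norm_nonneg _) hp).1 (hup b)
  refine ⟨?_, hcpt, ?_⟩
  · refine AddMonoidHomClass.continuous_of_bound (starAddEquiv : A ≃+ A) m fun a => ?_
    have h := hle (a : B) ((star a : A) : B) (hstar a)
    rwa [UniformSpace.Completion.norm_coe, UniformSpace.Completion.norm_coe] at h
  choose σ hσ using fun b : B => hsurj (star (WeakDual.gelfandTransform ℂ B b))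
  let sr : StarRing B :=
    { star := σ
      star_involutive := fun b => hinj (by rw [hσ, hσ, star_star])
      star_mul := fun a b => hinj (by
        change WeakDual.gelfandTransform ℂ B (σ (a * b)) = WeakDual.gelfandTransform ℂ B (σ b * σ a)
        rw [hσ, map_mul, map_mul, hσ, hσ, star_mul])
      star_add := fun a b => hinj (by
        change WeakDual.gelfandTransform ℂ B (σ (a + b)) = WeakDual.gelfandTransform ℂ B (σ a + σ b)
        rw [hσ, map_add, map_add, hσ, hσ, star_add]) }
  have hG : ∀ b : B, WeakDual.gelfandTransform ℂ B (star b)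
      = star (WeakDual.gelfandTransform ℂ B b) := hσ
  refine ⟨sr, ⟨fun z b => hinj ?_⟩, ?_, fun a => hinj ?_, ⟨hinj, hsurj⟩, hG, fun b => ⟨?_, ?_⟩⟩
  · rw [hG, map_smul, map_smul, hG, star_smul]
  · exact AddMonoidHomClass.continuous_of_bound (starAddEquiv : B ≃+ B) m fun b => hle b _ (hG b)
  · rw [hG, hstar]
  -- The estimate in hand has the sharper constant `m ^ (-1 / p)`; weakening it needs `1 ≤ m`, which
  -- follows from `1 ≤ ‖1‖ ≤ m` once `b ≠ 0` makes `B` nontrivial.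
  · rcases eq_or_ne b 0 with rfl | hb
    · simp [Real.zero_rpow (inv_ne_zero hp.ne')]
    have : Nontrivial B := ⟨b, 0, hb⟩
    have hone : 0 < ‖(1 : B)‖ := norm_pos_iff.2 one_ne_zero
    have hm1 : 1 ≤ m := by
      have h1 := hsqB 1
      rw [one_pow, pow_two] at h1
      have h2 : ‖(1 : B)‖ ≤ m := le_of_mul_le_mul_right h1 hone
      have h3 := norm_mul_le (1 : B) 1
      rw [one_mul] at h3
      exact ((le_mul_iff_one_le_right hone).1 h3).trans h2
    have h5 : (‖b‖ / m) ^ p⁻¹ ≤ ‖WeakDual.gelfandTransform ℂ B b‖ :=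
      (Real.rpow_inv_le_iff_of_pos (by positivity) (norm_nonneg _) hp).2
        ((div_le_iff₀' hm).2 (hlow b))
    refine le_trans ?_ h5
    rw [Real.div_rpow (norm_nonneg _) hm.le, div_eq_inv_mul (‖b‖ ^ p⁻¹), ← Real.rpow_neg hm.le, one_div]
    gcongr
    · rw [div_eq_mul_inv]
      have : 0 < p⁻¹ := by positivity
      linarith
  · rw [one_div]
    exact hup b
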